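/- Let $\xi>-1$ be real, let $\mathbb{D}$ be the open unit disc, and let $d\nu_\xi(z)=\frac{\xi+1}{\pi}(1-|z|^2)^\xi\,dA(z)$, where $dA$ is the area measure on $\mathbb{D}$. Let $\mathcal{A}^2_\xi$ be the weighted Bergman space of all holomorphic functions $f$ on $\mathbb{D}$ with $\int_{\mathbb{D}}|f|^2\,d\nu_\xi<\infty$, a Hilbert space with the inner product $\langle f,g\rangle_\xi=\int_{\mathbb{D}}f\overline{g}\,d\nu_\xi$. A (possibly unbounded) linear operator $A$ in $\mathcal{A}^2_\xi$, with domain $\mathcal{D}(A)\subseteq\mathcal{A}^2_\xi$, is called a first-order differential operator if there are $f,g\in\mathcal{A}^2_\xi$ such that $Ah=fh'+gh$ on $\mathbb{D}$ for all $h\in\mathcal{D}(A)$. The commutator $[A,B]=AB-BA$ of two operators has the domain of all $h\in\mathcal{D}(A)\cap\mathcal{D}(B)$ with $Bh\in\mathcal{D}(A)$ and $Ah\in\mathcal{D}(B)$. Theorem. There are no self-adjoint first-order differential operators $A,B$ in $\mathcal{A}^2_\xi$ and no $\eta\in\mathbb{C}\setminus\{0\}$ such that the closure $\overline{[A,B]}$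 equals $\eta$ times the identity operator of $\mathcal{A}^2_\xi$. -/

import Mathlib

open MeasureTheory Metric Set Filter
open scoped ENNReal NNReal Topology Real

noncomputable section

namespace WeightedBergman

/-! ### The weighted area measure -/

/-- The weighted area measure `dν_ξ(z) = (ξ + 1) / π * (1 - |z|²) ^ ξ dA(z)` on the open unit disc,
viewed as a measure on `ℂ` that is carried by the disc. -/
def diskMeasure (ξ : ℝ) : Measure ℂ :=
  (volume.restrict (ball (0 : ℂ) 1)).withDensity
    fun z => ENNReal.ofReal ((ξ + 1) / π * (1 - ‖z‖ ^ 2) ^ ξ)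

/-! ### The weighted Bergman space -/

/-- The weighted Bergman space `A²_ξ`: the elements of `L²(ν_ξ)` that are represented by a
function which is holomorphic on the open unit disc, with the inner product of `L²(ν_ξ)`. -/
def bergmanSpace (ξ : ℝ) : Submodule ℂ (Lp ℂ 2 (diskMeasure ξ)) where
  carrier := {u | ∃ F : ℂ → ℂ, DifferentiableOn ℂ F (ball 0 1) ∧ u =ᵐ[diskMeasure ξ] F}
  zero_mem' := ⟨0, differentiableOn_const 0, Lp.coeFn_zero _ _ _⟩
  add_mem' := by
    rintro u v ⟨F, hF, hu⟩ ⟨G, hG, hv⟩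
    exact ⟨F + G, hF.add hG, (Lp.coeFn_add u v).trans (hu.add hv)⟩
  smul_mem' := by
    rintro c u ⟨F, hF, hu⟩
    refine ⟨c • F, hF.const_smul c, (Lp.coeFn_smul c u).trans ?_⟩
    filter_upwards [hu] with z hz
    simp [hz]

/-- The holomorphic function on the unit disc given by an element of `A²_ξ`
(its values outside the disc carry no meaning). -/
def holo {ξ : ℝ} (u : bergmanSpace ξ) : ℂ → ℂ := u.2.choose

theorem holo_differentiableOn {ξ : ℝ} (u : bergmanSpace ξ) :
    DifferentiableOn ℂ (holo u) (ball 0 1) := u.2.choose_spec.1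

theorem holo_ae_eq {ξ : ℝ} (u : bergmanSpace ξ) :
    (u : Lp ℂ 2 (diskMeasure ξ)) =ᵐ[diskMeasure ξ] holo u := u.2.choose_spec.2

/-! ### Completeness of the weighted Bergman space -/

theorem enorm_mul_le_circle {f : ℂ → ℂ} {c : ℂ} {r s : ℝ}
    (hf : DifferentiableOn ℂ f (ball c r)) (hs : 0 < s) (hsr : s < r) :
    ‖f c‖ₑ * ENNReal.ofReal (2 * π) ≤
      ∫⁻ θ in Ioo (-π) π, ‖f (c + Complex.polarCoord.symm (s, θ))‖ₑ := by
  have h1 : DiffContOnCl ℂ f (ball c |s|) := by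
    rw [abs_of_pos hs]
    refine DifferentiableOn.diffContOnCl ?_
    rw [closure_ball c hs.ne']
    exact hf.mono (closedBall_subset_ball hsr)
  have h2 := h1.circleAverage
  rw [Real.circleAverage_eq_integral_add (-π)] at h2
  have h3 : (2 * π : ℂ) * f c = ∫ θ in Ioo (-π) π, f (c + Complex.polarCoord.symm (s, θ)) := by
    rw [← h2, intervalIntegral.integral_comp_add_right (fun θ => f (circleMap c s θ)),
      intervalIntegral.integral_of_le (by linarith [Real.pi_pos]),
      integral_Ioc_eq_integral_Ioo]
    have : (0 : ℝ) + -π = -π := by ring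
    rw [this]
    have : 2 * π + -π = π := by ring
    rw [this, Complex.real_smul]
    push_cast
    rw [← mul_assoc, mul_inv_cancel₀ (by simp), one_mul]
    congr 1
    ext θ
    rw [Complex.polarCoord_symm_apply, circleMap, Complex.exp_mul_I]
    push_cast
    rfl
  calc ‖f c‖ₑ * ENNReal.ofReal (2 * π) = ‖(2 * π : ℂ) * f c‖ₑ := by
        rw [enorm_mul, mul_comm]
        congr 1
        rw [← ofReal_norm]
        congr 1
        simp [abs_of_pos Real.pi_pos]
    _ ≤ _ := by
        rw [h3]
        exact enorm_integral_le_lintegral_enorm _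

theorem enorm_mul_volume_le {f : ℂ → ℂ} {c : ℂ} {r : ℝ} (hf : DifferentiableOn ℂ f (ball c r)) :
    ‖f c‖ₑ * volume (ball c r) ≤ ∫⁻ z in ball c r, ‖f z‖ₑ := by
  have key : ∀ g : ℂ → ℝ≥0∞, Measurable ((ball (0 : ℂ) r).indicator fun z => g (c + z)) →
      ∫⁻ z in ball c r, g z = ∫⁻ s in Ioi (0 : ℝ), ∫⁻ θ in Ioo (-π) π,
        ENNReal.ofReal s *
          (ball (0 : ℂ) r).indicator (fun z => g (c + z)) (Complex.polarCoord.symm (s, θ)) := by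
    intro g hg
    rw [← lintegral_indicator measurableSet_ball,
      ← lintegral_add_left_eq_self ((ball c r).indicator g) c]
    have : (fun z => (ball c r).indicator g (c + z))
        = (ball (0 : ℂ) r).indicator fun z => g (c + z) := by
      ext z
      simp [indicator]
    rw [this, ← Complex.lintegral_comp_polarCoord_symm, polarCoord_target,
      Measure.volume_eq_prod, ← Measure.prod_restrict, lintegral_prod]
    · rfl
    · refine Measurable.aemeasurable ?_
      simp only [smul_eq_mul, Complex.polarCoord_symm_apply]
      refine (by fun_prop : Measurable fun p : ℝ × ℝ => ENNReal.ofReal p.1).mul ?_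
      exact hg.comp (by fun_prop)
  have hmeas : Measurable ((ball (0 : ℂ) r).indicator fun z => ‖f (c + z)‖ₑ) := by
    have hc : ContinuousOn (fun z => ‖f (c + z)‖ₑ) (ball (0 : ℂ) r) := by
      refine continuous_enorm.comp_continuousOn (hf.continuousOn.comp (by fun_prop) ?_)
      intro z hz
      simpa using hz
    classical
    rw [← piecewise_eq_indicator]
    exact hc.measurable_piecewise continuousOn_const measurableSet_ball
  rw [← setLIntegral_const, key _ (measurable_const.indicator measurableSet_ball), key _ hmeas]
  refine setLIntegral_mono' measurableSet_Ioi fun s hs => ?_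
  rw [lintegral_const_mul' _ _ ENNReal.ofReal_ne_top, lintegral_const_mul' _ _ ENNReal.ofReal_ne_top]
  refine mul_le_mul' le_rfl ?_
  by_cases hsr : s < r
  · have hmem : ∀ θ : ℝ, Complex.polarCoord.symm (s, θ) ∈ ball (0 : ℂ) r := fun θ => by
      rw [mem_ball_zero_iff, Complex.norm_polarCoord_symm]
      simpa [abs_of_pos (mem_Ioi.1 hs)] using hsr
    rw [setLIntegral_congr_fun measurableSet_Ioo fun θ _ => indicator_of_mem (hmem θ) _,
      setLIntegral_congr_fun measurableSet_Ioo fun θ _ => indicator_of_mem (hmem θ) _,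
      setLIntegral_const, Real.volume_Ioo, show π - -π = 2 * π by ring]
    exact enorm_mul_le_circle hf hs hsr
  · have hmem : ∀ θ : ℝ, Complex.polarCoord.symm (s, θ) ∉ ball (0 : ℂ) r := fun θ => by
      rw [mem_ball_zero_iff, Complex.norm_polarCoord_symm]
      simpa [abs_of_pos (mem_Ioi.1 hs)] using hsr
    rw [setLIntegral_congr_fun measurableSet_Ioo fun θ _ => indicator_of_notMem (hmem θ) _]
    simp

/-- Point evaluations are bounded in the norm of `L²(ν_ξ)`, uniformly on compact subsets. -/
theorem exists_enorm_le {ξ : ℝ} (hξ : -1 < ξ) {R : ℝ} (hR : R < 1) :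
    ∃ C : ℝ≥0∞, C ≠ ∞ ∧ ∀ F : ℂ → ℂ, DifferentiableOn ℂ F (ball 0 1) →
      ∀ z ∈ closedBall (0 : ℂ) R, ‖F z‖ₑ ≤ C * eLpNorm F 2 (diskMeasure ξ) := by
  set ρ : ℝ := (1 - R) / 2 with hρ
  set R' : ℝ := (1 + R) / 2 with hR'
  have hρ0 : 0 < ρ := by linarith
  have hR'1 : R' < 1 := by linarith
  obtain ⟨m, hm0, hm⟩ : ∃ m : ℝ, 0 < m ∧ ∀ z ∈ closedBall (0 : ℂ) R',
      m ≤ (ξ + 1) / π * (1 - ‖z‖ ^ 2) ^ ξ := by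
    have hpos : ∀ z ∈ closedBall (0 : ℂ) R', 0 < 1 - ‖z‖ ^ 2 := fun z hz => by
      have := mem_closedBall_zero_iff.1 hz
      nlinarith [norm_nonneg z]
    rcases (closedBall (0 : ℂ) R').eq_empty_or_nonempty with he | hne
    · exact ⟨1, one_pos, by simp [he]⟩
    · have hc : ContinuousOn (fun z : ℂ => (ξ + 1) / π * (1 - ‖z‖ ^ 2) ^ ξ)
          (closedBall (0 : ℂ) R') := by
        refine continuousOn_const.mul (ContinuousOn.rpow_const (by fun_prop) ?_)
        exact fun z hz => Or.inl (hpos z hz).ne'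
      obtain ⟨w, hw, hmin⟩ := (isCompact_closedBall (0 : ℂ) R').exists_isMinOn hne hc
      exact ⟨_, mul_pos (div_pos (by linarith) Real.pi_pos) (Real.rpow_pos_of_pos (hpos w hw) _),
        fun z hz => hmin hz⟩
  set κ : Measure ℂ := volume.restrict (ball (0 : ℂ) R') with hκ
  have hκν : κ ≤ (ENNReal.ofReal m)⁻¹ • diskMeasure ξ := by
    have h0 : ENNReal.ofReal m ≠ 0 := by simpa using hm0
    refine Measure.le_iff.2 fun s hs => ?_
    rw [Measure.smul_apply, smul_eq_mul, ← ENNReal.div_eq_inv_mul,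
      ENNReal.le_div_iff_mul_le (Or.inl h0) (Or.inl ENNReal.ofReal_ne_top),
      diskMeasure, withDensity_apply _ hs, Measure.restrict_restrict hs, hκ,
      Measure.restrict_apply hs, mul_comm, ← setLIntegral_const]
    refine (setLIntegral_mono' (hs.inter measurableSet_ball) fun z hz => ?_).trans
      (lintegral_mono_set (inter_subset_inter_right s (ball_subset_ball hR'1.le)))
    exact ENNReal.ofReal_le_ofReal (hm z (ball_subset_closedBall hz.2))
  have hκfin : IsFiniteMeasure κ := ⟨by
    rw [hκ, Measure.restrict_apply_univ]; exact measure_ball_lt_top⟩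
  set D : ℝ≥0∞ := volume (ball (0 : ℂ) ρ) with hD
  have hD0 : D ≠ 0 := (measure_ball_pos volume (0 : ℂ) hρ0).ne'
  have hDt : D ≠ ∞ := measure_ball_lt_top.ne
  set K : ℝ≥0∞ := ((ENNReal.ofReal m)⁻¹) ^ (1 / (2 : ℝ≥0∞).toReal) with hK
  have hKt : K ≠ ∞ := ENNReal.rpow_ne_top_of_nonneg (by positivity)
    (ENNReal.inv_ne_top.2 (by simpa using hm0))
  set V : ℝ≥0∞ := κ univ ^ (1 / (1 : ℝ≥0∞).toReal - 1 / (2 : ℝ≥0∞).toReal) with hV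
  have hVt : V ≠ ∞ := ENNReal.rpow_ne_top_of_nonneg (by norm_num) (measure_ne_top κ univ)
  refine ⟨D⁻¹ * (K * V), ENNReal.mul_ne_top (ENNReal.inv_ne_top.2 hD0)
    (ENNReal.mul_ne_top hKt hVt), fun F hF z hz => ?_⟩
  have hz' : ‖z‖ ≤ R := mem_closedBall_zero_iff.1 hz
  have hsub : ball z ρ ⊆ ball (0 : ℂ) R' := ball_subset_ball' (by
    rw [dist_zero_right]; linarith)
  have hsub1 : ball (0 : ℂ) R' ⊆ ball 0 1 := ball_subset_ball hR'1.le
  have h1 : ‖F z‖ₑ * D ≤ eLpNorm F 1 κ := by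
    have := enorm_mul_volume_le (hF.mono (hsub.trans hsub1))
    rw [Measure.addHaar_ball_center] at this
    rw [eLpNorm_one_eq_lintegral_enorm]
    exact this.trans (lintegral_mono_set hsub)
  have hFm : AEStronglyMeasurable F κ :=
    (hF.continuousOn.mono hsub1).aestronglyMeasurable measurableSet_ball
  have h2 : eLpNorm F 1 κ ≤ eLpNorm F 2 κ * V :=
    eLpNorm_le_eLpNorm_mul_rpow_measure_univ (by norm_num) hFm
  have h3 : eLpNorm F 2 κ ≤ K * eLpNorm F 2 (diskMeasure ξ) := by
    refine (eLpNorm_mono_measure F hκν).trans ?_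
    rw [eLpNorm_smul_measure_of_ne_top (by norm_num), smul_eq_mul, hK, ENNReal.toReal_div]
    simp
  rw [mul_assoc, ← ENNReal.div_eq_inv_mul, ENNReal.le_div_iff_mul_le (Or.inl hD0) (Or.inl hDt)]
  calc ‖F z‖ₑ * D ≤ _ := h1.trans h2
    _ ≤ K * eLpNorm F 2 (diskMeasure ξ) * V := by gcongr
    _ = _ := by ring

/-- The holomorphic function on the disc that represents an element of `A²_ξ` is unique. -/
theorem eqOn_holo {ξ : ℝ} (hξ : -1 < ξ) (u : bergmanSpace ξ) {F : ℂ → ℂ}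
    (hF : DifferentiableOn ℂ F (ball 0 1))
    (hu : (u : Lp ℂ 2 (diskMeasure ξ)) =ᵐ[diskMeasure ξ] F) :
    EqOn (holo u) F (ball 0 1) := by
  intro z hz
  obtain ⟨C, -, hC⟩ := exists_enorm_le hξ (mem_ball_zero_iff.1 hz)
  have h := hC (holo u - F) ((holo_differentiableOn u).sub hF) z (by simp)
  have h0 : holo u - F =ᵐ[diskMeasure ξ] 0 := by
    filter_upwards [holo_ae_eq u, hu] with w h1 h2
    simp [← h1, ← h2]
  rw [eLpNorm_congr_ae h0, eLpNorm_zero, mul_zero, nonpos_iff_eq_zero, enorm_eq_zero] at h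
  exact sub_eq_zero.1 h

theorem isClosed_bergmanSpace (ξ : ℝ) :
    IsClosed (bergmanSpace ξ : Set (Lp ℂ 2 (diskMeasure ξ))) := by
  rcases le_or_gt ξ (-1) with hξ | hξ
  · have h0 : diskMeasure ξ = 0 := by
      rw [diskMeasure, ← withDensity_zero (μ := volume.restrict (ball (0 : ℂ) 1))]
      refine withDensity_congr_ae ?_
      refine (ae_restrict_iff' measurableSet_ball).2 (Eventually.of_forall fun z hz => ?_)
      have hz' : 0 ≤ 1 - ‖z‖ ^ 2 := by
        have := mem_ball_zero_iff.1 hz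
        nlinarith [norm_nonneg z]
      exact ENNReal.ofReal_of_nonpos (mul_nonpos_of_nonpos_of_nonneg
        (div_nonpos_of_nonpos_of_nonneg (by linarith) Real.pi_pos.le) (Real.rpow_nonneg hz' _))
    have : (bergmanSpace ξ : Set (Lp ℂ 2 (diskMeasure ξ))) = univ := by
      refine eq_univ_of_forall fun u => ⟨0, differentiableOn_const 0, ?_⟩
      rw [Filter.EventuallyEq, ae_iff]
      simp [h0]
    rw [this]
    exact isClosed_univ
  refine IsSeqClosed.isClosed fun x u hx hu => ?_
  choose F hF hxF using hx
  have hcau : ∀ R < 1, UniformCauchySeqOn F atTop (closedBall (0 : ℂ) R) := by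
    intro R hR
    obtain ⟨C, hCt, hC⟩ := exists_enorm_le hξ hR
    intro U hU
    obtain ⟨ε, hε, hεU⟩ := mem_uniformity_edist.1 hU
    obtain ⟨N, hN⟩ := EMetric.cauchySeq_iff.1 hu.cauchySeq (ε / (C + 1))
      (ENNReal.div_pos hε.ne' (by simp [hCt]))
    filter_upwards [prod_mem_prod (Ici_mem_atTop N) (Ici_mem_atTop N)]
    rintro ⟨m, n⟩ ⟨hm, hn⟩ z hz
    apply hεU
    have h1 := hC (F m - F n) ((hF m).sub (hF n)) z hz
    have h2 : eLpNorm (F m - F n) 2 (diskMeasure ξ) = edist (x m) (x n) := by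
      rw [Lp.edist_def]
      exact eLpNorm_congr_ae ((hxF m).sub (hxF n)).symm
    rw [h2] at h1
    rw [edist_eq_enorm_sub]
    calc ‖F m z - F n z‖ₑ ≤ C * edist (x m) (x n) := h1
      _ ≤ (C + 1) * edist (x m) (x n) := by gcongr; exact le_self_add
      _ < ε := by
        rw [mul_comm]
        exact (ENNReal.lt_div_iff_mul_lt (by simp) (by simp [hCt])).1 (hN m hm n hn)
  have hpt : ∀ z ∈ ball (0 : ℂ) 1, ∃ w, Tendsto (fun n => F n z) atTop (𝓝 w) := fun z hz =>
    cauchySeq_tendsto_of_complete ((hcau ‖z‖ (mem_ball_zero_iff.1 hz)).cauchySeq (by simp))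
  choose! G hG using hpt
  have hloc : TendstoLocallyUniformlyOn F G atTop (ball (0 : ℂ) 1) := by
    rw [tendstoLocallyUniformlyOn_iff_forall_isCompact isOpen_ball]
    intro K hK hKc
    obtain ⟨R, hR, hKR⟩ : ∃ R < 1, K ⊆ closedBall (0 : ℂ) R := by
      rcases K.eq_empty_or_nonempty with rfl | hne
      · exact ⟨0, one_pos, empty_subset _⟩
      · obtain ⟨w, hw, hmax⟩ := hKc.exists_isMaxOn hne continuous_norm.continuousOn
        exact ⟨‖w‖, mem_ball_zero_iff.1 (hK hw), fun z hz => mem_closedBall_zero_iff.2 (hmax hz)⟩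
    exact ((hcau R hR).mono hKR).tendstoUniformlyOn_of_tendsto fun z hz => hG z (hK hz)
  refine ⟨G, hloc.differentiableOn (Eventually.of_forall hF) isOpen_ball, ?_⟩
  obtain ⟨φ, hφ, hae⟩ := (tendstoInMeasure_of_tendsto_Lp hu).exists_seq_tendsto_ae
  have hball : ∀ᵐ z ∂diskMeasure ξ, z ∈ ball (0 : ℂ) 1 :=
    (withDensity_absolutelyContinuous _ _).ae_le (ae_restrict_mem measurableSet_ball)
  filter_upwards [hae, ae_all_iff.2 hxF, hball] with z h1 h2 h3
  refine tendsto_nhds_unique h1 ?_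
  simp only [h2]
  exact (hG z h3).comp hφ.tendsto_atTop

/-- `A²_ξ` is a Hilbert space. -/
instance (ξ : ℝ) : CompleteSpace (bergmanSpace ξ) :=
  (isClosed_bergmanSpace ξ).completeSpace_coe

/-! ### Unbounded operators -/

/-- The product `A B` of two unbounded operators, with its natural domain
`{x ∈ D(B) | B x ∈ D(A)}`. -/
def opMul {E : Type*} [AddCommGroup E] [Module ℂ E] (A B : E →ₗ.[ℂ] E) : E →ₗ.[ℂ] E :=
  A.comp (B.domRestrict ((A.domain.comap B.toFun).map B.domain.subtype)) (by
    rintro ⟨x, ⟨⟨y, hy, hyx⟩, hx⟩⟩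
    obtain rfl : y = ⟨x, hx⟩ := Subtype.ext hyx
    exact hy)

theorem mem_opMul_domain {E : Type*} [AddCommGroup E] [Module ℂ E] {A B : E →ₗ.[ℂ] E} {x : E} :
    x ∈ (opMul A B).domain ↔ ∃ hx : x ∈ B.domain, B ⟨x, hx⟩ ∈ A.domain := by
  constructor
  · rintro ⟨⟨y, hy, hyx⟩, hx⟩
    obtain rfl : y = ⟨x, hx⟩ := Subtype.ext hyx
    exact ⟨hx, hy⟩
  · rintro ⟨hx, h⟩
    exact ⟨⟨⟨x, hx⟩, h, rfl⟩, hx⟩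

theorem opMul_apply {E : Type*} [AddCommGroup E] [Module ℂ E] {A B : E →ₗ.[ℂ] E} {x : E}
    (h : x ∈ (opMul A B).domain) (hx : x ∈ B.domain) (hBx : B ⟨x, hx⟩ ∈ A.domain) :
    opMul A B ⟨x, h⟩ = A ⟨B ⟨x, hx⟩, hBx⟩ := rfl

/-- The commutator `[A, B] = A B - B A` of two unbounded operators, with domain
`D(A B) ∩ D(B A)`. -/
def commutator {E : Type*} [AddCommGroup E] [Module ℂ E] (A B : E →ₗ.[ℂ] E) : E →ₗ.[ℂ] E :=
  opMul A B - opMul B A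

/-- The everywhere defined operator `η • 1`. -/
def scalarOp (E : Type*) [AddCommGroup E] [Module ℂ E] (η : ℂ) : E →ₗ.[ℂ] E :=
  (η • (LinearMap.id : E →ₗ[ℂ] E)).toPMap ⊤

/-! ### First-order differential operators -/

/-- An operator `A` in `A²_ξ` (with any domain) is a first-order differential operator if there
are coefficients `f, g ∈ A²_ξ` such that `A h = f h' + g h` on the unit disc for all `h` in the
domain of `A`. -/
def IsFirstOrderDiffOp {ξ : ℝ} (A : bergmanSpace ξ →ₗ.[ℂ] bergmanSpace ξ) : Prop :=
  ∃ f g : bergmanSpace ξ, ∀ h : A.domain, ∀ z ∈ ball (0 : ℂ) 1,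
    holo (A h) z = holo f z * deriv (holo (h : bergmanSpace ξ)) z
      + holo g z * holo (h : bergmanSpace ξ) z

end WeightedBergman

end

/-! Self-adjointness forces the coefficients to be polynomials. Since h(0), h'(0) and h''(0) are
multiples of the inner products of h with 1, z and z², the functionals h ↦ ⟨1, Ah⟩ and h ↦ ⟨z, Ah⟩
on the domain of A are inner products with explicit polynomials. Hence 1 and z lie in the domain of
A* = A, and A1 = g, Az = f + zg are known. With s = ξ + 2 this gives f = a + bz + āz² and g = c +
sāz (`exists_coeff_of_isSelfAdjoint`).

In the commutator the second-order terms cancel, leaving Fu' + Gu with F = f₁f₂' - f₂f₁' and G =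
f₁g₂' - f₂g₁' (`holo_commutator`). Put κ = a₁ā₂ - a₂ā₁. Then F has linear coefficient 2κ and G(0) =
sκ. If the closure is η times the identity, then Fu' + (G - η)u = 0 for u in a dense domain. Its
value and derivative at 0 are continuous functionals of u, so they vanish identically
(`coeff_eq_zero_of_dense`). Testing on 1 and z gives sκ = η and 2κ + (sκ - η) = 0, so κ = 0 and η =
0. -/

noncomputable section
namespace WeightedBergman

/-! ### Radial moments -/

/-- The moments `∫₀¹ 2 r r^{2n} (1 - r²)^ξ dr` of the radial weight. -/
def radialMoment (ξ : ℝ) (n : ℕ) : ℝ :=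
  ∫ r in (0 : ℝ)..1, 2 * r * (r ^ 2) ^ n * (1 - r ^ 2) ^ ξ

theorem hasDerivAt_one_sub_sq_rpow (ξ : ℝ) {r : ℝ} (hr : r ∈ Ioo (0 : ℝ) 1) :
    HasDerivAt (fun r : ℝ => (1 - r ^ 2) ^ (ξ + 1)) (-((ξ + 1) * (2 * r * (1 - r ^ 2) ^ ξ))) r := by
  have h0 : 0 < 1 - r ^ 2 := by nlinarith [hr.1, hr.2]
  have h1 : HasDerivAt (fun r : ℝ => 1 - r ^ 2) (-(2 * r)) r := by
    simpa using (hasDerivAt_pow 2 r).const_sub 1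
  convert h1.rpow_const (p := ξ + 1) (Or.inl h0.ne') using 1
  rw [add_sub_cancel_right]
  ring

theorem continuousOn_one_sub_sq_rpow {ξ : ℝ} (hξ : -1 < ξ) :
    ContinuousOn (fun r : ℝ => (1 - r ^ 2) ^ (ξ + 1)) (Icc 0 1) :=
  ContinuousOn.rpow_const (by fun_prop) fun _ _ => Or.inr (by linarith)

/-- For ξ < 0 the integrand is unbounded near 1. Up to the factor ξ + 1 it is the nonnegative
derivative of a function continuous on [0, 1], and this makes it integrable. -/
theorem intervalIntegrable_radial {ξ : ℝ} (hξ : -1 < ξ) :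
    IntervalIntegrable (fun r : ℝ => 2 * r * (1 - r ^ 2) ^ ξ) volume 0 1 := by
  have h := intervalIntegral.integrableOn_deriv_of_nonneg
    (g := fun r : ℝ => -(1 - r ^ 2) ^ (ξ + 1)) (g' := fun r => (ξ + 1) * (2 * r * (1 - r ^ 2) ^ ξ))
    (continuousOn_one_sub_sq_rpow hξ).neg
    (fun r hr => by
      have := (hasDerivAt_one_sub_sq_rpow ξ hr).neg
      rw [neg_neg] at this
      exact this)
    (fun r hr => by
      have h0 : 0 < 1 - r ^ 2 := by nlinarith [hr.1, hr.2]
      have := hr.1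
      have : 0 < ξ + 1 := by linarith
      positivity)
  rw [intervalIntegrable_iff_integrableOn_Ioc_of_le zero_le_one]
  have h2 := h.const_mul (ξ + 1)⁻¹
  refine h2.congr (Eventually.of_forall fun r => ?_)
  have : ξ + 1 ≠ 0 := by linarith
  simp only
  field_simp

theorem intervalIntegrable_radialMoment {ξ : ℝ} (hξ : -1 < ξ) (n : ℕ) :
    IntervalIntegrable (fun r : ℝ => 2 * r * (r ^ 2) ^ n * (1 - r ^ 2) ^ ξ) volume 0 1 := by
  have h := (intervalIntegrable_radial hξ).mul_continuousOn (g := fun r : ℝ => (r ^ 2) ^ n)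
    (by fun_prop)
  convert h using 2
  ring

theorem radialMoment_zero {ξ : ℝ} (hξ : -1 < ξ) : (ξ + 1) * radialMoment ξ 0 = 1 := by
  have h := intervalIntegral.integral_eq_sub_of_hasDerivAt_of_le zero_le_one
    (continuousOn_one_sub_sq_rpow hξ)
    (fun r hr => hasDerivAt_one_sub_sq_rpow ξ hr)
    ((intervalIntegrable_radial hξ).const_mul (ξ + 1)).neg
  rw [intervalIntegral.integral_neg, intervalIntegral.integral_const_mul] at h
  have h0 : ξ + 1 ≠ 0 := by linarith
  simp [Real.zero_rpow h0] at h
  simpa [radialMoment] using h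

/-- Integrate the derivative of r^(2n+2) (1 - r²)^(ξ+1), which vanishes at both endpoints, and split
one factor 1 - r² off the power. -/
theorem radialMoment_succ {ξ : ℝ} (hξ : -1 < ξ) (n : ℕ) :
    (n + 1) * radialMoment ξ n = (n + 2 + ξ) * radialMoment ξ (n + 1) := by
  have hd : ∀ r ∈ Ioo (0 : ℝ) 1, HasDerivAt (fun r : ℝ => (r ^ 2) ^ (n + 1) * (1 - r ^ 2) ^ (ξ + 1))
      ((n + 1) * (2 * r * (r ^ 2) ^ n * (1 - r ^ 2) ^ ξ)
        - (n + 2 + ξ) * (2 * r * (r ^ 2) ^ (n + 1) * (1 - r ^ 2) ^ ξ)) r := by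
    intro r hr
    have h0 : 0 < 1 - r ^ 2 := by nlinarith [hr.1, hr.2]
    have h1 := ((hasDerivAt_pow 2 r).pow (n + 1)).mul (hasDerivAt_one_sub_sq_rpow ξ hr)
    refine h1.congr_deriv ?_
    rw [Real.rpow_add_one h0.ne']
    push_cast
    simp only [Pi.pow_apply]
    ring
  have hi := intervalIntegrable_radialMoment hξ
  have h := intervalIntegral.integral_eq_sub_of_hasDerivAt_of_le zero_le_one
    (ContinuousOn.mul (by fun_prop) (continuousOn_one_sub_sq_rpow hξ)) hd
    (((hi n).const_mul _).sub ((hi (n + 1)).const_mul _))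
  rw [intervalIntegral.integral_sub ((hi n).const_mul _) ((hi (n + 1)).const_mul _),
    intervalIntegral.integral_const_mul, intervalIntegral.integral_const_mul] at h
  have h0 : ξ + 1 ≠ 0 := by linarith
  simp [Real.zero_rpow h0] at h
  exact sub_eq_zero.1 h

/-! ### Integration in polar coordinates -/

theorem measurable_weight (ξ : ℝ) :
    Measurable fun z : ℂ => ENNReal.ofReal ((ξ + 1) / π * (1 - ‖z‖ ^ 2) ^ ξ) := by
  fun_prop

theorem isFiniteMeasure_diskMeasure {ξ : ℝ} (hξ : -1 < ξ) : IsFiniteMeasure (diskMeasure ξ) := by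
  have h : IntegrableOn (fun z : ℂ => (ξ + 1) / π * (1 - ‖z‖ ^ 2) ^ ξ) (ball 0 1) := by
    rw [integrableOn_fun_norm_addHaar volume (f := fun r : ℝ => (ξ + 1) / π * (1 - r ^ 2) ^ ξ)]
    have h := (intervalIntegrable_radial hξ).const_mul ((ξ + 1) / π / 2)
    rw [intervalIntegrable_iff_integrableOn_Ioo_of_le zero_le_one] at h
    refine h.congr (Eventually.of_forall fun r => ?_)
    simp only [Complex.finrank_real_complex, smul_eq_mul]
    ring
  exact isFiniteMeasure_withDensity_ofReal h.2

theorem ae_mem_ball (ξ : ℝ) : ∀ᵐ z ∂diskMeasure ξ, z ∈ ball (0 : ℂ) 1 :=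
  (withDensity_absolutelyContinuous _ _).ae_le (ae_restrict_mem measurableSet_ball)

theorem measurable_indicator_ball {F : ℂ → ℂ} (hF : ContinuousOn F (ball 0 1)) :
    Measurable ((ball (0 : ℂ) 1).indicator F) := by
  classical
  rw [← piecewise_eq_indicator]
  exact hF.measurable_piecewise continuousOn_const measurableSet_ball

theorem integral_diskMeasure_eq {ξ : ℝ} (hξ : -1 < ξ) (F : ℂ → ℂ) :
    ∫ z, F z ∂diskMeasure ξ =
      ∫ z, (ball (0 : ℂ) 1).indicator (fun z => ((ξ + 1) / π * (1 - ‖z‖ ^ 2) ^ ξ) • F z) z := by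
  rw [diskMeasure, integral_withDensity_eq_integral_toReal_smul (measurable_weight ξ) (by simp),
    integral_indicator measurableSet_ball]
  refine setIntegral_congr_fun measurableSet_ball fun z hz => ?_
  rw [ENNReal.toReal_ofReal]
  have : 0 < 1 - ‖z‖ ^ 2 := by nlinarith [norm_nonneg z, mem_ball_zero_iff.1 hz]
  have : 0 < ξ + 1 := by linarith
  positivity

theorem integrable_comp_polarCoord_symm {F : ℂ → ℂ} (hm : Measurable F) (hF : Integrable F) :
    IntegrableOn (fun p : ℝ × ℝ => p.1 • F (Complex.polarCoord.symm p))
      (Ioi (0 : ℝ) ×ˢ Ioo (-π) π) := by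
  have hc : Measurable fun p : ℝ × ℝ => Complex.polarCoord.symm p := by
    simp only [Complex.polarCoord_symm_apply]
    fun_prop
  refine ⟨((measurable_fst).smul (hm.comp hc)).aestronglyMeasurable, ?_⟩
  have h := hF.2
  rw [hasFiniteIntegral_iff_enorm, ← Complex.lintegral_comp_polarCoord_symm] at h
  rw [hasFiniteIntegral_iff_enorm]
  refine lt_of_le_of_lt (le_of_eq ?_) h
  rw [polarCoord_target]
  refine setLIntegral_congr_fun (measurableSet_Ioi.prod measurableSet_Ioo) fun p hp => ?_
  simp only [enorm_smul, smul_eq_mul]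
  rw [Real.enorm_of_nonneg (mem_Ioi.1 hp.1).le]

/-- Extending the weighted integrand by zero makes it measurable and integrable on the plane, so the
planar polar formula and Fubini apply; radii r ≥ 1 contribute nothing. -/
theorem integral_diskMeasure_polar {ξ : ℝ} (hξ : -1 < ξ) {F : ℂ → ℂ}
    (hFc : ContinuousOn F (ball 0 1)) (hF : Integrable F (diskMeasure ξ)) :
    ∫ z, F z ∂diskMeasure ξ =
      ∫ r in Ioo (0 : ℝ) 1, ((ξ + 1) / π * (r * (1 - r ^ 2) ^ ξ)) •
        ∫ θ in Ioo (-π) π, F (Complex.polarCoord.symm (r, θ)) := by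
  set G : ℂ → ℂ :=
    (ball (0 : ℂ) 1).indicator (fun z => ((ξ + 1) / π * (1 - ‖z‖ ^ 2) ^ ξ) • F z) with hG
  have hGm : Measurable G := by
    refine measurable_indicator_ball (ContinuousOn.fun_smul ?_ hFc)
    refine continuousOn_const.mul (ContinuousOn.rpow_const (by fun_prop) fun z hz => Or.inl ?_)
    have := mem_ball_zero_iff.1 hz
    nlinarith [norm_nonneg z]
  have hGi : Integrable G := by
    rw [hG, integrable_indicator_iff measurableSet_ball]
    rw [diskMeasure, integrable_withDensity_iff_integrable_smul' (measurable_weight ξ)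
      (by simp)] at hF
    refine hF.congr ?_
    filter_upwards [ae_restrict_mem measurableSet_ball] with z hz
    rw [ENNReal.toReal_ofReal]
    have : 0 < 1 - ‖z‖ ^ 2 := by nlinarith [norm_nonneg z, mem_ball_zero_iff.1 hz]
    have : 0 < ξ + 1 := by linarith
    positivity
  rw [integral_diskMeasure_eq hξ, ← hG, ← Complex.integral_comp_polarCoord_symm, polarCoord_target,
    Measure.volume_eq_prod, setIntegral_prod _ (integrable_comp_polarCoord_symm hGm hGi),
    setIntegral_eq_of_subset_of_forall_sdiff_eq_zero measurableSet_Ioi Ioo_subset_Ioi_self]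
  · refine setIntegral_congr_fun measurableSet_Ioo fun r hr => ?_
    simp only
    rw [← integral_smul]
    refine setIntegral_congr_fun measurableSet_Ioo fun θ _ => ?_
    have hn : ‖Complex.polarCoord.symm (r, θ)‖ = r := by
      rw [Complex.norm_polarCoord_symm, abs_of_pos hr.1]
    rw [hG, indicator_of_mem (by rw [mem_ball_zero_iff, hn]; exact hr.2), hn, smul_smul]
    congr 1
    ring
  · rintro r ⟨hr0, hr1⟩
    have hr : 1 ≤ r := not_lt.1 fun h => hr1 ⟨hr0, h⟩
    have hn : ∀ θ : ℝ, Complex.polarCoord.symm (r, θ) ∉ ball (0 : ℂ) 1 := fun θ => by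
      rw [mem_ball_zero_iff, Complex.norm_polarCoord_symm, not_lt]
      exact hr.trans (le_abs_self r)
    simp only [hG, indicator_of_notMem (hn _), smul_zero, integral_zero]

/-- On the circle of radius r the conjugate of z is r²/z, so this is Cauchy's formula for the n-th
derivative at 0. -/
theorem integral_conj_pow_mul_circle {h : ℂ → ℂ} (hh : DifferentiableOn ℂ h (ball 0 1)) (n : ℕ)
    {r : ℝ} (hr : r ∈ Ioo (0 : ℝ) 1) :
    ∫ θ in Ioo (-π) π, (starRingEnd ℂ) (Complex.polarCoord.symm (r, θ) ^ n)
        * h (Complex.polarCoord.symm (r, θ)) =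
      (2 * π * (r ^ 2) ^ n : ℝ) * (iteratedDeriv n h 0 / n.factorial) := by
  have hc := (hh.mono (closedBall_subset_ball hr.2)).circleIntegral_one_div_sub_center_pow_smul
    hr.1 n
  -- Periodicity moves the angle from (0, 2π), used by circle integrals, to (-π, π), used by polar
  -- coordinates.
  have hper : Function.Periodic
      (fun θ => deriv (circleMap 0 r) θ • ((1 / (circleMap 0 r θ - 0) ^ (n + 1)) •
        h (circleMap 0 r θ))) (2 * π) := by
    intro θ
    simp only [deriv_circleMap, (periodic_circleMap 0 r) θ]
  have e := hper.intervalIntegral_add_eq 0 (-π)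
  rw [zero_add, show -π + 2 * π = π by ring] at e
  rw [circleIntegral, e, intervalIntegral.integral_of_le (by linarith [Real.pi_pos]),
    integral_Ioc_eq_integral_Ioo] at hc
  have hr0 : (r : ℂ) ≠ 0 := by exact_mod_cast hr.1.ne'
  -- The factor 1/i comes from dz = iz dθ.
  have key : ∀ θ : ℝ, (starRingEnd ℂ) (Complex.polarCoord.symm (r, θ) ^ n)
        * h (Complex.polarCoord.symm (r, θ)) = (((r : ℂ) ^ 2) ^ n / Complex.I) *
      (deriv (circleMap 0 r) θ • ((1 / (circleMap 0 r θ - 0) ^ (n + 1)) •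
        h (circleMap 0 r θ))) := by
    intro θ
    have hp : Complex.polarCoord.symm (r, θ) = circleMap 0 r θ := by
      rw [Complex.polarCoord_symm_apply, circleMap_zero, Complex.exp_mul_I]
      push_cast
      rfl
    have hz : circleMap 0 r θ ≠ 0 := circleMap_ne_center hr.1.ne'
    have hcj : (starRingEnd ℂ) (circleMap 0 r θ) = (r : ℂ) ^ 2 / circleMap 0 r θ := by
      rw [eq_div_iff hz, mul_comm, Complex.mul_conj, Complex.normSq_eq_norm_sq]
      simp
    rw [hp, map_pow, hcj, deriv_circleMap]
    simp only [smul_eq_mul, sub_zero]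
    have := Complex.I_ne_zero
    rw [div_pow]
    field_simp
    ring
  simp only [key]
  rw [integral_const_mul, hc]
  have := Complex.I_ne_zero
  simp only [smul_eq_mul]
  push_cast
  field_simp

theorem integral_conj_pow_mul {ξ : ℝ} (hξ : -1 < ξ) {h : ℂ → ℂ}
    (hh : DifferentiableOn ℂ h (ball 0 1)) (n : ℕ)
    (hi : Integrable (fun z => (starRingEnd ℂ) (z ^ n) * h z) (diskMeasure ξ)) :
    ∫ z, (starRingEnd ℂ) (z ^ n) * h z ∂diskMeasure ξ =
      ((ξ + 1) * radialMoment ξ n : ℝ) * (iteratedDeriv n h 0 / n.factorial) := by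
  have hc : ContinuousOn (fun z => (starRingEnd ℂ) (z ^ n) * h z) (ball 0 1) :=
    ContinuousOn.mul (Continuous.continuousOn (by fun_prop)) hh.continuousOn
  rw [integral_diskMeasure_polar hξ hc hi, radialMoment,
    intervalIntegral.integral_of_le zero_le_one, integral_Ioc_eq_integral_Ioo, ← integral_const_mul,
    ← integral_complex_ofReal, ← integral_mul_const]
  refine setIntegral_congr_fun measurableSet_Ioo fun r hr => ?_
  rw [integral_conj_pow_mul_circle hh n hr, Complex.real_smul, ← mul_assoc, ← Complex.ofReal_mul]
  congr 2
  have := Real.pi_ne_zero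
  field_simp

/-! ### Monomials in the Bergman space -/

theorem memLp_pow {ξ : ℝ} (hξ : -1 < ξ) (n : ℕ) :
    MemLp (fun z : ℂ => z ^ n) 2 (diskMeasure ξ) := by
  have := isFiniteMeasure_diskMeasure hξ
  refine MemLp.of_bound (by fun_prop) 1 ?_
  filter_upwards [ae_mem_ball ξ] with z hz
  rw [norm_pow]
  exact pow_le_one₀ (norm_nonneg z) (mem_ball_zero_iff.1 hz).le

/-- The monomial `z ^ n` as an element of `A²_ξ`. -/
def monomial {ξ : ℝ} (hξ : -1 < ξ) (n : ℕ) : bergmanSpace ξ :=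
  ⟨(memLp_pow hξ n).toLp, fun z => z ^ n, by fun_prop, (memLp_pow hξ n).coeFn_toLp⟩

section

variable {ξ : ℝ}

local notation "⟪" x ", " y "⟫" => inner ℂ x y

theorem holo_monomial (hξ : -1 < ξ) (n : ℕ) :
    EqOn (holo (monomial hξ n)) (fun z => z ^ n) (ball 0 1) :=
  eqOn_holo hξ _ (by fun_prop) (memLp_pow hξ n).coeFn_toLp

/-- `holo` is chosen separately for each element, so it is additive only on the disc, by uniqueness
of the holomorphic representative. -/
theorem holo_add (hξ : -1 < ξ) (u v : bergmanSpace ξ) :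
    EqOn (holo (u + v)) (holo u + holo v) (ball 0 1) :=
  eqOn_holo hξ _ ((holo_differentiableOn u).add (holo_differentiableOn v))
    ((Lp.coeFn_add _ _).trans ((holo_ae_eq u).add (holo_ae_eq v)))

theorem holo_smul (hξ : -1 < ξ) (c : ℂ) (u : bergmanSpace ξ) :
    EqOn (holo (c • u)) (c • holo u) (ball 0 1) :=
  eqOn_holo hξ _ ((holo_differentiableOn u).const_smul c)
    ((Lp.coeFn_smul _ _).trans ((holo_ae_eq u).const_smul c))

/-- The real factor is the squared norm of zⁿ, the other one the n-th Taylor coefficient of u. -/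
theorem inner_monomial (hξ : -1 < ξ) (n : ℕ) (u : bergmanSpace ξ) :
    ⟪monomial hξ n, u⟫ =
      ((ξ + 1) * radialMoment ξ n : ℝ) * (iteratedDeriv n (holo u) 0 / n.factorial) := by
  have hae : (fun z => ⟪(monomial hξ n : Lp ℂ 2 (diskMeasure ξ)) z, (u : Lp ℂ 2 (diskMeasure ξ)) z⟫)
      =ᵐ[diskMeasure ξ] fun z => (starRingEnd ℂ) (z ^ n) * holo u z := by
    filter_upwards [(memLp_pow hξ n).coeFn_toLp, holo_ae_eq u] with z h1 h2
    have h1' : (monomial hξ n : Lp ℂ 2 (diskMeasure ξ)) z = z ^ n := h1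
    rw [h1', h2, RCLike.inner_apply, mul_comm]
  rw [← integral_conj_pow_mul hξ (holo_differentiableOn u) n
    ((L2.integrable_inner _ _).congr hae), Submodule.coe_inner, L2.inner_def]
  exact integral_congr_ae hae

theorem inner_smul_left_bergmanSpace (c : ℂ) (u v : bergmanSpace ξ) :
    ⟪c • u, v⟫ = (starRingEnd ℂ) c * ⟪u, v⟫ :=
  inner_smul_left u v c

/-! ### Derivatives at the origin as inner products with monomials -/

theorem moment_one (hξ : -1 < ξ) : (ξ + 1) * radialMoment ξ 1 = (ξ + 2)⁻¹ := by
  have h0 := radialMoment_zero hξ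
  have h1 := radialMoment_succ hξ 0
  have : ξ + 2 ≠ 0 := by linarith
  norm_num at h1
  refine eq_inv_of_mul_eq_one_left ?_
  linear_combination h0 - (ξ + 1) * h1

theorem moment_two (hξ : -1 < ξ) :
    (ξ + 1) * radialMoment ξ 2 = 2 * ((ξ + 2) * (ξ + 3))⁻¹ := by
  have h0 := moment_one hξ
  have h1 := radialMoment_succ hξ 1
  have h2 : ξ + 2 ≠ 0 := by linarith
  have h3 : ξ + 3 ≠ 0 := by linarith
  norm_num at h1
  field_simp at h0 ⊢
  linear_combination 2 * h0 - (ξ + 1) * (ξ + 2) * h1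

theorem add_two_ne_zero (hξ : -1 < ξ) : (ξ : ℂ) + 2 ≠ 0 := by
  exact_mod_cast (by linarith : ξ + 2 ≠ 0)

theorem add_three_ne_zero (hξ : -1 < ξ) : (ξ : ℂ) + 3 ≠ 0 := by
  exact_mod_cast (by linarith : ξ + 3 ≠ 0)

theorem holo_zero_eq_inner (hξ : -1 < ξ) (u : bergmanSpace ξ) :
    holo u 0 = ⟪monomial hξ 0, u⟫ := by
  rw [inner_monomial, radialMoment_zero hξ]
  simp

theorem deriv_holo_zero_eq_inner (hξ : -1 < ξ) (u : bergmanSpace ξ) :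
    deriv (holo u) 0 = (ξ + 2) * ⟪monomial hξ 1, u⟫ := by
  rw [inner_monomial, moment_one hξ, iteratedDeriv_one]
  have := add_two_ne_zero hξ
  push_cast
  field_simp
  simp

theorem deriv_deriv_holo_zero_eq_inner (hξ : -1 < ξ) (u : bergmanSpace ξ) :
    deriv (deriv (holo u)) 0 = (ξ + 2) * (ξ + 3) * ⟪monomial hξ 2, u⟫ := by
  rw [inner_monomial, moment_two hξ, iteratedDeriv_succ, iteratedDeriv_one]
  have := add_two_ne_zero hξ
  have := add_three_ne_zero hξ
  push_cast
  field_simp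
  simp

theorem hasDerivAt_holo (u : bergmanSpace ξ) {z : ℂ} (hz : z ∈ ball (0 : ℂ) 1) :
    HasDerivAt (holo u) (deriv (holo u) z) z :=
  ((holo_differentiableOn u).differentiableAt (isOpen_ball.mem_nhds hz)).hasDerivAt

theorem hasDerivAt_deriv_holo (u : bergmanSpace ξ) {z : ℂ} (hz : z ∈ ball (0 : ℂ) 1) :
    HasDerivAt (deriv (holo u)) (deriv (deriv (holo u)) z) z :=
  (((holo_differentiableOn u).deriv isOpen_ball).differentiableAt
    (isOpen_ball.mem_nhds hz)).hasDerivAt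

theorem deriv_holo_monomial (hξ : -1 < ξ) (n : ℕ) {z : ℂ} (hz : z ∈ ball (0 : ℂ) 1) :
    deriv (holo (monomial hξ n)) z = n * z ^ (n - 1) := by
  rw [((holo_monomial hξ n).eventuallyEq_of_mem (isOpen_ball.mem_nhds hz)).deriv_eq]
  simp

/-! ### The coefficients of a self-adjoint first-order operator -/

/-- The hypothesis says that y is in the domain of the adjoint, with image w. Self-adjointness
enters the main proof only through this lemma. -/
theorem exists_apply_eq_of_isSelfAdjoint {E : Type*} [NormedAddCommGroup E] [InnerProductSpace ℂ E]
    [CompleteSpace E] {A : E →ₗ.[ℂ] E} (hA : IsSelfAdjoint A) {y w : E}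
    (h : ∀ x : A.domain, ⟪w, (x : E)⟫ = ⟪y, A x⟫) : ∃ hy : y ∈ A.domain, A ⟨y, hy⟩ = w := by
  have hA' : A.adjoint = A := hA
  have hy : y ∈ A.adjoint.domain := LinearPMap.mem_adjoint_domain_of_exists y ⟨w, h⟩
  have hw := LinearPMap.adjoint_apply_eq hA.dense_domain ⟨y, hy⟩ h
  -- Domain membership depends on the operator, so the equality A* = A is substituted for a variable
  -- B.
  have key : ∀ B : E →ₗ.[ℂ] E, B = A → ∀ hB : y ∈ B.domain, B ⟨y, hB⟩ = w →
      ∃ hy : y ∈ A.domain, A ⟨y, hy⟩ = w := by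
    rintro B rfl hB h
    exact ⟨hB, h⟩
  exact key _ hA' hy hw

/-- The coefficients of a self-adjoint first-order differential operator in `A²_ξ`. -/
theorem exists_coeff_of_isSelfAdjoint (hξ : -1 < ξ) {A : bergmanSpace ξ →ₗ.[ℂ] bergmanSpace ξ}
    (hA : IsSelfAdjoint A) {f g : bergmanSpace ξ}
    (hfg : ∀ h : A.domain, ∀ z ∈ ball (0 : ℂ) 1, holo (A h) z =
      holo f z * deriv (holo (h : bergmanSpace ξ)) z + holo g z * holo (h : bergmanSpace ξ) z) :
    ∃ a b c : ℂ, ∀ z ∈ ball (0 : ℂ) 1,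
      holo f z = a + b * z + (starRingEnd ℂ) a * z ^ 2 ∧
      holo g z = c + (ξ + 2) * (starRingEnd ℂ) a * z := by
  have h0 : (0 : ℂ) ∈ ball (0 : ℂ) 1 := by simp
  have hs2 := add_two_ne_zero hξ
  set a := holo f 0 with ha
  set c := holo g 0 with hc
  -- Here w is read off from (Ah)(0) = a h'(0) + c h(0); its coefficients are conjugated because the
  -- inner product is conjugate-linear on the left.
  obtain ⟨m0, hm0⟩ := exists_apply_eq_of_isSelfAdjoint hA (y := monomial hξ 0)
    (w := ((ξ + 2) * (starRingEnd ℂ) a) • monomial hξ 1 + (starRingEnd ℂ) c • monomial hξ 0)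
    fun h => by
      rw [← holo_zero_eq_inner, hfg h 0 h0, deriv_holo_zero_eq_inner hξ, inner_add_left,
        inner_smul_left_bergmanSpace, inner_smul_left_bergmanSpace, holo_zero_eq_inner hξ (h : bergmanSpace ξ)]
      simp only [map_mul, map_add, Complex.conj_conj, Complex.conj_ofReal, map_ofNat]
      ring
  -- A1 = g, so g is the polynomial w just found.
  have hg : ∀ z ∈ ball (0 : ℂ) 1,
      holo g z = (starRingEnd ℂ) c + (ξ + 2) * (starRingEnd ℂ) a * z := by
    intro z hz
    have h := hfg ⟨_, m0⟩ z hz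
    rw [hm0, holo_add hξ _ _ hz, Pi.add_apply, holo_smul hξ _ _ hz, holo_smul hξ _ _ hz,
      Pi.smul_apply, Pi.smul_apply, holo_monomial hξ _ hz, holo_monomial hξ _ hz,
      deriv_holo_monomial hξ _ hz] at h
    simp at h
    rw [← h]
    ring
  -- Now w comes from ⟨z, Ah⟩ = (Ah)'(0) / (ξ + 2), expanded by the product rule.
  obtain ⟨m1, hm1⟩ := exists_apply_eq_of_isSelfAdjoint hA (y := monomial hξ 1)
    (w := ((ξ + 3) * (starRingEnd ℂ) a) • monomial hξ 2
      + ((starRingEnd ℂ) (deriv (holo f) 0 + c) • monomial hξ 1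
      + (starRingEnd ℂ) (deriv (holo g) 0 / (ξ + 2)) • monomial hξ 0))
    fun h => by
      have hd : deriv (holo (A h)) 0 =
          (deriv (holo f) 0 * deriv (holo (h : bergmanSpace ξ)) 0
            + holo f 0 * deriv (deriv (holo (h : bergmanSpace ξ))) 0)
          + (deriv (holo g) 0 * holo (h : bergmanSpace ξ) 0
            + holo g 0 * deriv (holo (h : bergmanSpace ξ)) 0) := by
        have he : holo (A h) =ᶠ[𝓝 0] fun z => holo f z * deriv (holo (h : bergmanSpace ξ)) z
            + holo g z * holo (h : bergmanSpace ξ) z :=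
          EqOn.eventuallyEq_of_mem (hfg h) (isOpen_ball.mem_nhds h0)
        rw [he.deriv_eq]
        exact (((hasDerivAt_holo f h0).mul (hasDerivAt_deriv_holo _ h0)).add
          ((hasDerivAt_holo g h0).mul (hasDerivAt_holo _ h0))).deriv
      have e : ⟪monomial hξ 1, A h⟫ = deriv (holo (A h)) 0 / (ξ + 2) := by
        rw [deriv_holo_zero_eq_inner hξ]
        field_simp
      rw [e, hd, ← ha, ← hc, deriv_holo_zero_eq_inner hξ (h : bergmanSpace ξ),
        deriv_deriv_holo_zero_eq_inner hξ (h : bergmanSpace ξ),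
        holo_zero_eq_inner hξ (h : bergmanSpace ξ), inner_add_left, inner_add_left,
        inner_smul_left_bergmanSpace, inner_smul_left_bergmanSpace, inner_smul_left_bergmanSpace]
      simp only [map_mul, map_add, Complex.conj_conj, Complex.conj_ofReal, map_ofNat]
      field_simp
      ring
  -- Az = f + zg; subtracting zg leaves the z² coefficient (ξ + 3)ā - (ξ + 2)ā = ā.
  have hf : ∀ z ∈ ball (0 : ℂ) 1, holo f z = (starRingEnd ℂ) (deriv (holo g) 0 / (ξ + 2))
      + (starRingEnd ℂ) (deriv (holo f) 0) * z + (starRingEnd ℂ) a * z ^ 2 := by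
    intro z hz
    have h := hfg ⟨_, m1⟩ z hz
    rw [hm1, holo_add hξ _ _ hz, Pi.add_apply, holo_add hξ _ _ hz, Pi.add_apply,
      holo_smul hξ _ _ hz, holo_smul hξ _ _ hz, holo_smul hξ _ _ hz,
      Pi.smul_apply, Pi.smul_apply, Pi.smul_apply, holo_monomial hξ _ hz, holo_monomial hξ _ hz,
      holo_monomial hξ _ hz, deriv_holo_monomial hξ _ hz, hg z hz] at h
    simp only [smul_eq_mul, pow_one, pow_zero, mul_one, Nat.cast_one, Nat.sub_self, map_add] at h
    linear_combination -h
  have ha' : (starRingEnd ℂ) (deriv (holo g) 0 / (ξ + 2)) = a := by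
    have := hf 0 h0
    rw [← ha] at this
    rw [this]
    ring
  rw [ha'] at hf
  exact ⟨a, _, _, fun z hz => ⟨hf z hz, hg z hz⟩⟩

/-! ### Commutators -/

theorem dense_domain_of_closure_eq_scalarOp {E : Type*} [NormedAddCommGroup E] [NormedSpace ℂ E]
    {T : E →ₗ.[ℂ] E} {η : ℂ} (h : T.closure = scalarOp E η) : Dense (T.domain : Set E) := by
  by_cases hT : T.IsClosable
  · have hg := hT.graph_closure_eq_closure_graph
    rw [h] at hg
    intro x
    have hx : (x, η • x) ∈ (scalarOp E η).graph :=
      (LinearPMap.mem_graph_iff _).2 ⟨⟨x, trivial⟩, rfl, rfl⟩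
    rw [← hg, ← SetLike.mem_coe, Submodule.topologicalClosure_coe] at hx
    refine map_mem_closure continuous_fst hx fun p hp => ?_
    obtain ⟨y, hy, -⟩ := (LinearPMap.mem_graph_iff _).1 hp
    rw [← hy]
    exact y.2
  -- For a non-closable operator `closure` returns the operator itself, which is then everywhere
  -- defined.
  · rw [LinearPMap.closure_def' hT] at h
    rw [h]
    exact dense_univ

theorem apply_eq_of_closure_eq_scalarOp {E : Type*} [NormedAddCommGroup E] [NormedSpace ℂ E]
    {T : E →ₗ.[ℂ] E} {η : ℂ} (h : T.closure = scalarOp E η) (x : T.domain) :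
    T x = η • (x : E) := by
  have hle := T.le_closure
  rw [h] at hle
  exact hle.2 (y := ⟨x, trivial⟩) rfl

/-- The functional is a combination of inner products with monomials, hence continuous, and vanishes
on the whole space. The test functions 1 and z have zero second derivative, so they isolate α and β.
-/
theorem coeff_eq_zero_of_dense (hξ : -1 < ξ) {D : Submodule ℂ (bergmanSpace ξ)}
    (hD : Dense (D : Set (bergmanSpace ξ))) {α β γ : ℂ}
    (h : ∀ u ∈ D, α * holo u 0 + β * deriv (holo u) 0 + γ * deriv (deriv (holo u)) 0 = 0) :
    α = 0 ∧ β = 0 := by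
  have h0 : (0 : ℂ) ∈ ball (0 : ℂ) 1 := by simp
  have hall : ∀ u : bergmanSpace ξ,
      α * holo u 0 + β * deriv (holo u) 0 + γ * deriv (deriv (holo u)) 0 = 0 := by
    simp only [holo_zero_eq_inner hξ, deriv_holo_zero_eq_inner hξ,
      deriv_deriv_holo_zero_eq_inner hξ] at h ⊢
    intro u
    have hcont : ∀ n, Continuous fun u : bergmanSpace ξ => ⟪monomial hξ n, u⟫ := fun n =>
      (innerSL ℂ (monomial hξ n)).continuous
    exact closure_minimal h (isClosed_eq ((((hcont 0).const_mul _).add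
      (((hcont 1).const_mul _).const_mul _)).add (((hcont 2).const_mul _).const_mul _))
      continuous_const) (hD u)
  have hd : ∀ n, deriv (deriv (holo (monomial hξ n))) 0 = n * ((n - 1 : ℕ) * 0 ^ (n - 1 - 1)) := by
    intro n
    have he : deriv (holo (monomial hξ n)) =ᶠ[𝓝 0] fun z => n * z ^ (n - 1) :=
      EqOn.eventuallyEq_of_mem (fun z hz => deriv_holo_monomial hξ n hz) (isOpen_ball.mem_nhds h0)
    rw [he.deriv_eq]
    simp
  have e0 := hall (monomial hξ 0)
  have e1 := hall (monomial hξ 1)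
  rw [hd, deriv_holo_monomial hξ _ h0, holo_monomial hξ _ h0] at e0 e1
  simp at e0 e1
  exact ⟨e0, e1⟩

theorem holo_commutator (hξ : -1 < ξ) {A B : bergmanSpace ξ →ₗ.[ℂ] bergmanSpace ξ}
    {f₁ g₁ f₂ g₂ : bergmanSpace ξ}
    (hA : ∀ h : A.domain, ∀ z ∈ ball (0 : ℂ) 1, holo (A h) z =
      holo f₁ z * deriv (holo (h : bergmanSpace ξ)) z + holo g₁ z * holo (h : bergmanSpace ξ) z)
    (hB : ∀ h : B.domain, ∀ z ∈ ball (0 : ℂ) 1, holo (B h) z =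
      holo f₂ z * deriv (holo (h : bergmanSpace ξ)) z + holo g₂ z * holo (h : bergmanSpace ξ) z)
    (h : (commutator A B).domain) {z : ℂ} (hz : z ∈ ball (0 : ℂ) 1) :
    holo (commutator A B h) z =
      (holo f₁ z * deriv (holo f₂) z - holo f₂ z * deriv (holo f₁) z)
        * deriv (holo (h : bergmanSpace ξ)) z
      + (holo f₁ z * deriv (holo g₂) z - holo f₂ z * deriv (holo g₁) z)
        * holo (h : bergmanSpace ξ) z := by
  obtain ⟨u, hu1, hu2⟩ := h
  obtain ⟨hxB, hBA⟩ := mem_opMul_domain.1 hu1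
  obtain ⟨hxA, hAB⟩ := mem_opMul_domain.1 hu2
  have hd : ∀ {C : bergmanSpace ξ →ₗ.[ℂ] bergmanSpace ξ} {f g : bergmanSpace ξ}
      (_ : ∀ h : C.domain, ∀ z ∈ ball (0 : ℂ) 1, holo (C h) z =
        holo f z * deriv (holo (h : bergmanSpace ξ)) z + holo g z * holo (h : bergmanSpace ξ) z)
      (hx : u ∈ C.domain), deriv (holo (C ⟨u, hx⟩)) z =
        (deriv (holo f) z * deriv (holo u) z + holo f z * deriv (deriv (holo u)) z)
          + (deriv (holo g) z * holo u z + holo g z * deriv (holo u) z) := by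
    intro C f g hC hx
    have he : holo (C ⟨u, hx⟩) =ᶠ[𝓝 z] fun z => holo f z * deriv (holo u) z
        + holo g z * holo u z :=
      EqOn.eventuallyEq_of_mem (hC ⟨u, hx⟩) (isOpen_ball.mem_nhds hz)
    rw [he.deriv_eq]
    exact (((hasDerivAt_holo f hz).mul (hasDerivAt_deriv_holo _ hz)).add
      ((hasDerivAt_holo g hz).mul (hasDerivAt_holo _ hz))).deriv
  -- The difference is written with the scalar -1 so that `holo_add` and `holo_smul` apply.
  have hc : commutator A B ⟨u, hu1, hu2⟩ =
      A ⟨B ⟨u, hxB⟩, hBA⟩ + (-1 : ℂ) • B ⟨A ⟨u, hxA⟩, hAB⟩ := by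
    rw [neg_one_smul, ← sub_eq_add_neg]
    exact LinearPMap.sub_apply _ _ _
  rw [hc, holo_add hξ _ _ hz, Pi.add_apply, holo_smul hξ _ _ hz, Pi.smul_apply, smul_eq_mul,
    hA ⟨B ⟨u, hxB⟩, hBA⟩ z hz, hB ⟨A ⟨u, hxA⟩, hAB⟩ z hz]
  simp only
  rw [hd hA hxA, hd hB hxB, hA _ z hz, hB _ z hz]
  ring

end

end WeightedBergman
end

/-! ### Contradiction from the Taylor coefficients at the origin -/

open WeightedBergman in
theorem mainTheorem3 (ξ : ℝ) (hξ : -1 < ξ) :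
    ¬ ∃ (A B : WeightedBergman.bergmanSpace ξ →ₗ.[ℂ] WeightedBergman.bergmanSpace ξ) (η : ℂ),
      WeightedBergman.IsFirstOrderDiffOp A ∧ IsSelfAdjoint A ∧
      WeightedBergman.IsFirstOrderDiffOp B ∧ IsSelfAdjoint B ∧
      η ≠ 0 ∧
      (WeightedBergman.commutator A B).closure =
        WeightedBergman.scalarOp (WeightedBergman.bergmanSpace ξ) η := by
  rintro ⟨A, B, η, ⟨f₁, g₁, hA⟩, hAs, ⟨f₂, g₂, hB⟩, hBs, hη, hcl⟩
  obtain ⟨a₁, b₁, c₁, h₁⟩ := exists_coeff_of_isSelfAdjoint hξ hAs hA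
  obtain ⟨a₂, b₂, c₂, h₂⟩ := exists_coeff_of_isSelfAdjoint hξ hBs hB
  have h0 : (0 : ℂ) ∈ ball (0 : ℂ) 1 := by simp
  have hD := dense_domain_of_closure_eq_scalarOp hcl
  have hdf : ∀ {f : bergmanSpace ξ} {a b c : ℂ}
      (_ : ∀ z ∈ ball (0 : ℂ) 1, holo f z = a + b * z + c * z ^ 2),
      ∀ z ∈ ball (0 : ℂ) 1, deriv (holo f) z = b + 2 * c * z := by
    intro f a b c hf z hz
    have he : holo f =ᶠ[𝓝 z] fun z => a + b * z + c * z ^ 2 :=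
      EqOn.eventuallyEq_of_mem hf (isOpen_ball.mem_nhds hz)
    rw [he.deriv_eq]
    have hd := (((hasDerivAt_id' z).const_mul b).const_add a).add
      ((hasDerivAt_pow 2 z).const_mul c)
    refine hd.deriv.trans ?_
    push_cast
    ring
  have hf₁ := hdf fun z hz => (h₁ z hz).1
  have hf₂ := hdf fun z hz => (h₂ z hz).1
  have hg₁ := hdf (b := (ξ + 2) * (starRingEnd ℂ) a₁) (c := 0) fun z hz => by
    rw [(h₁ z hz).2]
    ring
  have hg₂ := hdf (b := (ξ + 2) * (starRingEnd ℂ) a₂) (c := 0) fun z hz => by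
    rw [(h₂ z hz).2]
    ring
  set s : ℂ := (ξ : ℂ) + 2
  set d₁ := (starRingEnd ℂ) a₁
  set d₂ := (starRingEnd ℂ) a₂
  -- The zeroth-order coefficient has no z² term: s d₁d₂ cancels because the slope of each g is s
  -- times the z² coefficient of its f.
  have key : ∀ u ∈ (commutator A B).domain, ∀ z ∈ ball (0 : ℂ) 1,
      ((a₁ * b₂ - a₂ * b₁) + 2 * (a₁ * d₂ - a₂ * d₁) * z + (b₁ * d₂ - b₂ * d₁) * z ^ 2)
        * deriv (holo u) z
      + (s * (a₁ * d₂ - a₂ * d₁) - η + s * (b₁ * d₂ - b₂ * d₁) * z) * holo u z = 0 := by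
    intro u hu z hz
    have h := holo_commutator hξ hA hB ⟨u, hu⟩ hz
    rw [apply_eq_of_closure_eq_scalarOp hcl, holo_smul hξ _ _ hz, Pi.smul_apply, smul_eq_mul,
      (h₁ z hz).1, (h₂ z hz).1, hf₁ z hz, hf₂ z hz, hg₁ z hz, hg₂ z hz] at h
    linear_combination -h
  obtain ⟨hV, -⟩ := coeff_eq_zero_of_dense hξ hD (α := s * (a₁ * d₂ - a₂ * d₁) - η)
    (β := a₁ * b₂ - a₂ * b₁) (γ := 0) fun u hu => by
      have h := key u hu 0 h0
      linear_combination h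
  -- These are the coefficients of u(0), u'(0) and u''(0) in the derivative of `key` at 0.
  obtain ⟨-, hW⟩ := coeff_eq_zero_of_dense hξ hD (α := s * (b₁ * d₂ - b₂ * d₁))
    (β := 2 * (a₁ * d₂ - a₂ * d₁) + (s * (a₁ * d₂ - a₂ * d₁) - η))
    (γ := a₁ * b₂ - a₂ * b₁) fun u hu => by
      have hd1 : ∀ p q r : ℂ, HasDerivAt (fun z : ℂ => p + q * z + r * z ^ 2) q 0 := by
        intro p q r
        have hd := (((hasDerivAt_id' (0 : ℂ)).const_mul q).const_add p).add
          ((hasDerivAt_pow 2 (0 : ℂ)).const_mul r)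
        refine hd.congr_deriv ?_
        simp
      have hd2 : ∀ p q : ℂ, HasDerivAt (fun z : ℂ => p + q * z) q 0 := by
        intro p q
        simpa using ((hasDerivAt_id' (0 : ℂ)).const_mul q).const_add p
      have hd := ((hd1 (a₁ * b₂ - a₂ * b₁) (2 * (a₁ * d₂ - a₂ * d₁)) (b₁ * d₂ - b₂ * d₁)).mul
        (hasDerivAt_deriv_holo u h0)).add
        ((hd2 (s * (a₁ * d₂ - a₂ * d₁) - η) (s * (b₁ * d₂ - b₂ * d₁))).mul (hasDerivAt_holo u h0))
      have he := hd.unique ((hasDerivAt_const (0 : ℂ) (0 : ℂ)).congr_of_eventuallyEq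
        (EqOn.eventuallyEq_of_mem (key u hu) (isOpen_ball.mem_nhds h0)))
      linear_combination he
  apply hη
  -- Eliminates κ = a₁d₂ - a₂d₁ from sκ - η = 0 and 2κ + (sκ - η) = 0.
  linear_combination (s / 2) * hW - (s / 2 + 1) * hV
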